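/- Let $\mathsf{Prop}=\{p_0,p_1,\dots\}$ be a countably infinite set of propositional variables and let formulas be given by $$\phi ::= p\in\mathsf{Prop}\mid{\sim}\phi\mid(\phi\wedge\phi)\mid(\phi\vee\phi)\mid(\phi\rightarrow\phi)\mid\Box\phi\mid\lozenge\phi .$$ A frame is a tuple $\langle W,\leq,R^+_\Box,R^-_\Box,R^+_\lozenge,R^-_\lozenge\rangle$ where $W\neq\varnothing$, $\leq$ is a preorder on $W$, and the $R$'s are arbitrary binary relations on $W$. A model adds two valuations $v^+,v^-:\mathsf{Prop}\to 2^W$ whose values are upward closed under $\leq$. Support of truth $\Vdash^+$ and support of falsity $\Vdash^-$ at $w\in W$ are defined by recursion: \begin{itemize} \item $w\Vdash^{+}p$ iff $w\in v^{+}(p)$; $w\Vdash^{-}p$ iff $w\in v^{-}(p)$; \item $w\Vdash^+{\sim}\phi$ iff $w\Vdash^-\phi$; $w\Vdash^-{\sim}\phi$ iff $w\Vdash^+\phi$; \item $w\Vdash^+\phi\wedge\chi$ iff $w\Vdash^+\phi$ and $w\Vdash^+\chi$; $w\Vdash^-\phi\wedge\chi$ iff $w\Vdash^-\phi$ or $w\Vdash^-\chi$;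 \item $w\Vdash^+\phi\vee\chi$ iff $w\Vdash^+\phi$ or $w\Vdash^+\chi$; $w\Vdash^-\phi\vee\chi$ iff $w\Vdash^-\phi$ and $w\Vdash^-\chi$; \item $w\Vdash^+\phi\rightarrow\chi$ iff for all $w'\geq w$, $w'\Vdash^+\phi$ implies $w'\Vdash^+\chi$; $w\Vdash^-\phi\rightarrow\chi$ iff $w\Vdash^+\phi$ and $w\Vdash^-\chi$; \item $w\Vdash^+\Box\phi$ iff for all $w'\geq w$ and all $w''$ with $w'R^+_\Box w''$, $w''\Vdash^+\phi$; $w\Vdash^-\Box\phi$ iff for all $w'\geq w$ there is $w''$ with $w'R^-_\Box w''$ and $w''\Vdash^-\phi$; \item $w\Vdash^+\lozenge\phi$ iff for all $w'\geq w$ there is $w''$ with $w'R^+_\lozenge w''$ and $w''\Vdash^+\phi$; $w\Vdash^-\lozenge\phi$ iff for all $w'\geq w$ and all $w''$ with $w'R^-_\lozenge w''$, $w''\Vdash^-\phi$. \end{itemize} A formula is valid in a logic if it is supported as true at every state of every model over a frame of that logic, where the frames are: for $\mathsf{CN4K}$, all frames; for $\mathsf{CN4K}^\curlyvee$, those with $R^+_\Box=R^-_\Box$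 and $R^+_\lozenge=R^-_\lozenge$; for $\mathsf{CN4K}^\pm$, those with $R^+_\Box=R^+_\lozenge$ and $R^-_\Box=R^-_\lozenge$; for $\mathsf{CN4K}^{\Join}$, those with $R^+_\Box=R^-_\lozenge$ and $R^+_\lozenge=R^-_\Box$; for $\mathsf{CN4K}^1$, those in which all four relations coincide. \textbf{Theorem.} For each $\mathsf L\in\{\mathsf{CN4K},\mathsf{CN4K}^\curlyvee,\mathsf{CN4K}^\pm,\mathsf{CN4K}^{\Join},\mathsf{CN4K}^1\}$, validity in $\mathsf L$ is decidable: there is an algorithm that, given a formula $\phi$ (coded by a standard Gödel number), decides whether $\phi$ is valid in $\mathsf L$. -/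

import Mathlib

universe u

namespace CN4K

/-- Formulas over the countable set `ℕ` of propositional variables, built with strong negation,
conjunction, disjunction, implication, and the two modalities. -/
inductive Formula : Type
  | var : ℕ → Formula
  | neg : Formula → Formula
  | and : Formula → Formula → Formula
  | or : Formula → Formula → Formula
  | imp : Formula → Formula → Formula
  | box : Formula → Formula
  | dia : Formula → Formula

namespace Formula

/-- Gödel numbering: the remainder modulo `7` is the outermost constructor, the quotient codes the
variable, the immediate subformula, or the pair of immediate subformulas. -/
def toNat : Formula → ℕ
  | var n => 7 * n
  | neg φ => 7 * φ.toNat + 1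
  | and φ χ => 7 * Nat.pair φ.toNat χ.toNat + 2
  | or φ χ => 7 * Nat.pair φ.toNat χ.toNat + 3
  | imp φ χ => 7 * Nat.pair φ.toNat χ.toNat + 4
  | box φ => 7 * φ.toNat + 5
  | dia φ => 7 * φ.toNat + 6

theorem toNat_injective : Function.Injective toNat := by
  intro φ
  induction φ with
  | var n => intro ψ h; cases ψ <;> simp only [toNat] at h <;> first | omega | (congr 1; omega)
  | neg φ ih | box φ ih | dia φ ih =>
    intro ψ h
    cases ψ <;> simp only [toNat] at h <;> first
      | omega
      | (congr 1; exact ih (by omega))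
  | and φ χ ih₁ ih₂ | or φ χ ih₁ ih₂ | imp φ χ ih₁ ih₂ =>
    intro ψ h
    cases ψ <;> simp only [toNat] at h <;> first
      | omega
      | (have h' := Nat.pair_eq_pair.1 (Nat.eq_of_mul_eq_mul_left (by norm_num) (Nat.add_right_cancel h))
         rw [ih₁ h'.1, ih₂ h'.2])

theorem toNat_surjective : Function.Surjective toNat := by
  intro n
  induction n using Nat.strong_induction_on with
  | _ n ih =>
    have hl := Nat.unpair_left_le (n / 7)
    have hr := Nat.unpair_right_le (n / 7)
    have hp := Nat.pair_unpair (n / 7)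
    rcases Nat.eq_zero_or_pos (n % 7) with h0 | h0
    · exact ⟨var (n / 7), by simp only [toNat]; omega⟩
    · obtain ⟨φ, hφ⟩ := ih (n / 7) (by omega)
      obtain ⟨φ₁, h₁⟩ := ih (n / 7).unpair.1 (by omega)
      obtain ⟨φ₂, h₂⟩ := ih (n / 7).unpair.2 (by omega)
      have hlt := Nat.mod_lt n (show 7 > 0 by norm_num)
      obtain h | h | h | h | h | h :
          n % 7 = 1 ∨ n % 7 = 2 ∨ n % 7 = 3 ∨ n % 7 = 4 ∨ n % 7 = 5 ∨ n % 7 = 6 := by omega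
      · exact ⟨neg φ, by simp only [toNat, hφ]; omega⟩
      · exact ⟨and φ₁ φ₂, by simp only [toNat, h₁, h₂, hp]; omega⟩
      · exact ⟨or φ₁ φ₂, by simp only [toNat, h₁, h₂, hp]; omega⟩
      · exact ⟨imp φ₁ φ₂, by simp only [toNat, h₁, h₂, hp]; omega⟩
      · exact ⟨box φ, by simp only [toNat, hφ]; omega⟩
      · exact ⟨dia φ, by simp only [toNat, hφ]; omega⟩

/-- The Gödel numbering as a bijection between formulas and natural numbers. -/
noncomputable def equivNat : Formula ≃ ℕ :=
  Equiv.ofBijective toNat ⟨toNat_injective, toNat_surjective⟩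

/-- Computability on formulas is computability on their Gödel numbers. -/
noncomputable instance : Primcodable Formula := Primcodable.ofEquiv ℕ equivNat

end Formula

/-- A frame: a non-empty preordered set of states with four arbitrary binary accessibility
relations, for the support of truth (`Pos`) and of falsity (`Neg`) of `□` and `◇`. -/
structure Frame where
  W : Type u
  nonempty : Nonempty W
  le : W → W → Prop
  le_refl : ∀ w, le w w
  le_trans : ∀ w w' w'', le w w' → le w' w'' → le w w''
  boxPos : W → W → Prop
  boxNeg : W → W → Prop
  diaPos : W → W → Prop
  diaNeg : W → W → Prop

/-- A model: a frame with two independent hereditary valuations. -/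
structure Model extends Frame.{u} where
  vPos : ℕ → W → Prop
  vNeg : ℕ → W → Prop
  vPos_mono : ∀ p w w', vPos p w → le w w' → vPos p w'
  vNeg_mono : ∀ p w w', vNeg p w → le w w' → vNeg p w'

mutual

/-- Positive support (support of truth) of a formula at a state. -/
def Model.Pos (M : Model.{u}) : Formula → M.W → Prop
  | .var p, w => M.vPos p w
  | .neg φ, w => M.Neg φ w
  | .and φ χ, w => M.Pos φ w ∧ M.Pos χ w
  | .or φ χ, w => M.Pos φ w ∨ M.Pos χ w
  | .imp φ χ, w => ∀ w', M.le w w' → M.Pos φ w' → M.Pos χ w'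
  | .box φ, w => ∀ w', M.le w w' → ∀ w'', M.boxPos w' w'' → M.Pos φ w''
  | .dia φ, w => ∀ w', M.le w w' → ∃ w'', M.diaPos w' w'' ∧ M.Pos φ w''

/-- Negative support (support of falsity) of a formula at a state. -/
def Model.Neg (M : Model.{u}) : Formula → M.W → Prop
  | .var p, w => M.vNeg p w
  | .neg φ, w => M.Pos φ w
  | .and φ χ, w => M.Neg φ w ∨ M.Neg χ w
  | .or φ χ, w => M.Neg φ w ∧ M.Neg χ w
  | .imp φ χ, w => M.Pos φ w ∧ M.Neg χ w
  | .box φ, w => ∀ w', M.le w w' → ∃ w'', M.boxNeg w' w'' ∧ M.Neg φ w''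
  | .dia φ, w => ∀ w', M.le w w' → ∀ w'', M.diaNeg w' w'' → M.Neg φ w''

end

/-- The five logics `CN4K`, `CN4K^⋎`, `CN4K^±`, `CN4K^⋈`, `CN4K^1`. -/
inductive Logic : Type
  | base
  | curlyvee
  | pm
  | join
  | one

/-- The class of frames that determines each logic. -/
def Logic.IsFrame : Logic → Frame.{u} → Prop
  | .base, _ => True
  | .curlyvee, F => F.boxPos = F.boxNeg ∧ F.diaPos = F.diaNeg
  | .pm, F => F.boxPos = F.diaPos ∧ F.boxNeg = F.diaNeg
  | .join, F => F.boxPos = F.diaNeg ∧ F.diaPos = F.boxNeg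
  | .one, F => F.boxPos = F.boxNeg ∧ F.boxPos = F.diaPos ∧ F.boxPos = F.diaNeg

/-- `φ` is valid in `L`: it is positively supported at every state of every model whose frame
belongs to the frame class of `L`. -/
def Logic.Valid (L : Logic) (φ : Formula) : Prop :=
  ∀ M : Model.{u}, L.IsFrame M.toFrame → ∀ w : M.W, M.Pos φ w

end CN4K

/-!
Validity is decided by a bounded search for a finite countermodel, obtained by filtration.

Two worlds of a model can support the same formulas and still differ in what their own successors
support, because `□` and `◇` quantify first over `≤` and then over an accessibility relation.
Filtration therefore records, besides support of truth and falsity, whether the inner quantifier of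
a modal formula holds at the world itself (`Mark.posLocal` and `Mark.negLocal`). The *type* of a
world is the set of its marks on formulas of Gödel number at most `n`, and is stored as the binary
digits of a number below `typeBound n`. A finite model is a set `S` of types, stored as the digits
of a number below `2 ^ typeBound n`; types are ordered by inclusion of their truth and falsity
marks, and each accessibility relation is the largest one that respects the local marks of all the
relations the logic identifies with it. `Coherent` says that the marks obey the clauses of the
definition of support in the model so obtained.

A coherent set is a model in which every formula has the support its marks announce
(`Coherent.support_iff`), and the types realized in an arbitrary model form a coherent set
(`coherent_realized`). So a formula is refutable in a logic exactly when some coherent set has a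
type without its truth mark (`not_valid_iff_refutable`). The latter condition has only bounded
quantifiers over primitive recursive relations, since all subformulas of a formula have smaller
Gödel numbers; hence it is primitive recursive.
-/

namespace CN4K

/-! ### Accessibility relations and persistence -/

/-- Names of the four accessibility relations of a frame. -/
inductive Rel : Type
  | boxPos
  | boxNeg
  | diaPos
  | diaNeg

/-- The accessibility relation of a frame with a given name. -/
def Frame.rel (F : Frame.{u}) : Rel → F.W → F.W → Prop
  | .boxPos => F.boxPos
  | .boxNeg => F.boxNeg
  | .diaPos => F.diaPos
  | .diaNeg => F.diaNeg

/-- A representative of the class of relations that a logic identifies with a given one. -/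
def Logic.rep : Logic → Rel → Rel
  | .base, r => r
  | .curlyvee, .boxPos => .boxPos
  | .curlyvee, .boxNeg => .boxPos
  | .curlyvee, .diaPos => .diaPos
  | .curlyvee, .diaNeg => .diaPos
  | .pm, .boxPos => .boxPos
  | .pm, .boxNeg => .boxNeg
  | .pm, .diaPos => .boxPos
  | .pm, .diaNeg => .boxNeg
  | .join, .boxPos => .boxPos
  | .join, .boxNeg => .boxNeg
  | .join, .diaPos => .boxNeg
  | .join, .diaNeg => .boxPos
  | .one, _ => .boxPos

theorem Logic.isFrame_iff (L : Logic) (F : Frame.{u}) :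
    L.IsFrame F ↔ ∀ r r', L.rep r = L.rep r' → F.rel r = F.rel r' := by
  constructor
  · intro h r r' hr
    cases L <;> cases r <;> cases r' <;>
      grind [Logic.rep, Logic.IsFrame, Frame.rel]
  · intro h
    cases L
    · trivial
    · exact ⟨h .boxPos .boxNeg rfl, h .diaPos .diaNeg rfl⟩
    · exact ⟨h .boxPos .diaPos rfl, h .boxNeg .diaNeg rfl⟩
    · exact ⟨h .boxPos .diaNeg rfl, h .diaPos .boxNeg rfl⟩
    · exact ⟨h .boxPos .boxNeg rfl, h .boxPos .diaPos rfl, h .boxPos .diaNeg rfl⟩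

theorem Model.persistent (M : Model.{u}) (φ : Formula) :
    ∀ w w', M.le w w' → (M.Pos φ w → M.Pos φ w') ∧ (M.Neg φ w → M.Neg φ w') := by
  induction φ with
  | var p =>
    intro w w' h
    simp only [Model.Pos, Model.Neg]
    exact ⟨fun hp => M.vPos_mono p w w' hp h, fun hp => M.vNeg_mono p w w' hp h⟩
  | neg φ ih =>
    intro w w' h
    simp only [Model.Pos, Model.Neg]
    exact (ih w w' h).symm
  | and φ χ ih₁ ih₂ | or φ χ ih₁ ih₂ =>
    intro w w' h
    have h₁ := ih₁ w w' h
    have h₂ := ih₂ w w' h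
    simp only [Model.Pos, Model.Neg]
    tauto
  | imp φ χ ih₁ ih₂ =>
    intro w w' h
    simp only [Model.Pos, Model.Neg]
    exact ⟨fun hp v hv => hp v (M.le_trans _ _ _ h hv),
      And.imp (ih₁ w w' h).1 (ih₂ w w' h).2⟩
  | box φ ih | dia φ ih =>
    intro w w' h
    simp only [Model.Pos, Model.Neg]
    exact ⟨fun hp v hv => hp v (M.le_trans _ _ _ h hv),
      fun hp v hv => hp v (M.le_trans _ _ _ h hv)⟩

/-! ### Types and coherent sets of types -/

/-- What a type may record about a formula: support of truth, support of falsity, and, for a modal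
formula, that the condition on the accessible worlds in the clause for its truth or for its falsity
holds at the world itself, if not at the worlds above it. -/
inductive Mark : Type
  | pos
  | neg
  | posLocal
  | negLocal

/-- The position of a mark in the block of four digits that belongs to a formula. -/
def Mark.index : Mark → ℕ
  | .pos => 0
  | .neg => 1
  | .posLocal => 2
  | .negLocal => 3

/-- The type `t` puts the mark `k` on the formula with Gödel number `m`. -/
def Has (t : ℕ) (k : Mark) (m : ℕ) : Prop :=
  t.testBit (4 * m + k.index) = true

/-- A strict upper bound for the types over the formulas with Gödel number at most `n`. -/
def typeBound (n : ℕ) : ℕ :=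
  2 ^ (4 * (n + 1))

/-- Membership in a set of types that is stored as the binary digits of `S`. -/
def Mem (S t : ℕ) : Prop :=
  S.testBit t = true

/-- The order on types: inclusion of the marks for truth and falsity. -/
def Below (n t t' : ℕ) : Prop :=
  ∀ m < n + 1, (Has t .pos m → Has t' .pos m) ∧ (Has t .neg m → Has t' .neg m)

/-- What the local marks of `t` on the formula with Gödel number `m` demand of a type `t'`
accessible by the relation `r`. A local mark for a universal condition imposes support on `t'`, and
the absence of one for an existential condition forbids it. -/
def Respects (m t t' : ℕ) : Rel → Prop
  | .boxPos => m % 7 = 5 → Has t .posLocal m → Has t' .pos (m / 7)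
  | .boxNeg => m % 7 = 5 → Has t' .neg (m / 7) → Has t .negLocal m
  | .diaPos => m % 7 = 6 → Has t' .pos (m / 7) → Has t .posLocal m
  | .diaNeg => m % 7 = 6 → Has t .negLocal m → Has t' .neg (m / 7)

/-- The accessibility relation `r` on types: all demands made by relations that `L` identifies
with `r` are met. -/
def Acc (L : Logic) (n : ℕ) (r : Rel) (t t' : ℕ) : Prop :=
  ∀ r', L.rep r = L.rep r' → ∀ m < n + 1, Respects m t t' r'

/-- The marks of the type `t` on the formula with Gödel number `m` obey the clause for its
outermost connective, evaluated in the set `S` of types. -/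
structure Clause (L : Logic) (n S t m : ℕ) : Prop where
  neg : m % 7 = 1 → (Has t .pos m ↔ Has t .neg (m / 7)) ∧ (Has t .neg m ↔ Has t .pos (m / 7))
  and : m % 7 = 2 →
    (Has t .pos m ↔ Has t .pos (m / 7).unpair.1 ∧ Has t .pos (m / 7).unpair.2) ∧
    (Has t .neg m ↔ Has t .neg (m / 7).unpair.1 ∨ Has t .neg (m / 7).unpair.2)
  or : m % 7 = 3 →
    (Has t .pos m ↔ Has t .pos (m / 7).unpair.1 ∨ Has t .pos (m / 7).unpair.2) ∧
    (Has t .neg m ↔ Has t .neg (m / 7).unpair.1 ∧ Has t .neg (m / 7).unpair.2)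
  imp : m % 7 = 4 →
    (Has t .pos m ↔ ∀ t' < typeBound n, Mem S t' → Below n t t' →
      Has t' .pos (m / 7).unpair.1 → Has t' .pos (m / 7).unpair.2) ∧
    (Has t .neg m ↔ Has t .pos (m / 7).unpair.1 ∧ Has t .neg (m / 7).unpair.2)
  box : m % 7 = 5 →
    (Has t .posLocal m ↔
      ∀ t' < typeBound n, Mem S t' → Acc L n .boxPos t t' → Has t' .pos (m / 7)) ∧
    (Has t .negLocal m ↔
      ∃ t' < typeBound n, Mem S t' ∧ Acc L n .boxNeg t t' ∧ Has t' .neg (m / 7))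
  dia : m % 7 = 6 →
    (Has t .posLocal m ↔
      ∃ t' < typeBound n, Mem S t' ∧ Acc L n .diaPos t t' ∧ Has t' .pos (m / 7)) ∧
    (Has t .negLocal m ↔
      ∀ t' < typeBound n, Mem S t' → Acc L n .diaNeg t t' → Has t' .neg (m / 7))
  modal : m % 7 = 5 ∨ m % 7 = 6 →
    (Has t .pos m ↔ ∀ t' < typeBound n, Mem S t' → Below n t t' → Has t' .posLocal m) ∧
    (Has t .neg m ↔ ∀ t' < typeBound n, Mem S t' → Below n t t' → Has t' .negLocal m)

/-- All marks on formulas of Gödel number at most `n`, in all types of `S`, obey their clauses. -/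
def Coherent (L : Logic) (n S : ℕ) : Prop :=
  ∀ t < typeBound n, Mem S t → ∀ m < n + 1, Clause L n S t m

/-- The formula with Gödel number `n` lacks the mark for truth at some type in a coherent set. -/
def Refutable (L : Logic) (n : ℕ) : Prop :=
  ∃ S < 2 ^ typeBound n, Coherent L n S ∧ ∃ t < typeBound n, Mem S t ∧ ¬ Has t .pos n

/-! ### From coherent sets to models -/

/-- The model whose worlds are the types in `S`. Variables of Gödel number above `n` have empty
valuations. -/
def typeModel (L : Logic) (n S t₀ : ℕ) (h₀ : t₀ < typeBound n ∧ Mem S t₀) : Model.{u} where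
  W := ULift {t // t < typeBound n ∧ Mem S t}
  nonempty := ⟨⟨t₀, h₀⟩⟩
  le t t' := Below n t.down t'.down
  le_refl _ _ _ := ⟨id, id⟩
  le_trans _ _ _ h h' m hm := ⟨(h' m hm).1 ∘ (h m hm).1, (h' m hm).2 ∘ (h m hm).2⟩
  boxPos t t' := Acc L n .boxPos t.down t'.down
  boxNeg t t' := Acc L n .boxNeg t.down t'.down
  diaPos t t' := Acc L n .diaPos t.down t'.down
  diaNeg t t' := Acc L n .diaNeg t.down t'.down
  vPos p t := 7 * p < n + 1 ∧ Has t.down .pos (7 * p)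
  vNeg p t := 7 * p < n + 1 ∧ Has t.down .neg (7 * p)
  vPos_mono _ _ _ h h' := ⟨h.1, (h' _ h.1).1 h.2⟩
  vNeg_mono _ _ _ h h' := ⟨h.1, (h' _ h.1).2 h.2⟩

theorem typeModel_isFrame (L : Logic) (n S t₀ : ℕ) (h₀ : t₀ < typeBound n ∧ Mem S t₀) :
    L.IsFrame (typeModel.{u} L n S t₀ h₀).toFrame := by
  have hrel : ∀ r, (typeModel.{u} L n S t₀ h₀).rel r = fun t t' => Acc L n r t.down t'.down := by
    intro r; cases r <;> rfl
  rw [Logic.isFrame_iff]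
  intro r r' h
  simp only [hrel, Acc, h]

theorem Coherent.support_iff {L : Logic} {n S t₀ : ℕ} (hS : Coherent L n S)
    (h₀ : t₀ < typeBound n ∧ Mem S t₀) (φ : Formula) (hφ : φ.toNat < n + 1) :
    ∀ t : (typeModel.{u} L n S t₀ h₀).W,
      ((typeModel L n S t₀ h₀).Pos φ t ↔ Has t.down .pos φ.toNat) ∧
      ((typeModel L n S t₀ h₀).Neg φ t ↔ Has t.down .neg φ.toNat) := by
  have worlds_forall : ∀ p : ℕ → Prop, (∀ t : (typeModel.{u} L n S t₀ h₀).W, p t.down) ↔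
      ∀ t < typeBound n, Mem S t → p t :=
    fun p => ⟨fun h t ht hm => h ⟨t, ht, hm⟩, fun h t => h _ t.down.2.1 t.down.2.2⟩
  have worlds_exists : ∀ p : ℕ → Prop, (∃ t : (typeModel.{u} L n S t₀ h₀).W, p t.down) ↔
      ∃ t < typeBound n, Mem S t ∧ p t :=
    fun p => ⟨fun ⟨t, h⟩ => ⟨_, t.down.2.1, t.down.2.2, h⟩,
      fun ⟨t, ht, hm, h⟩ => ⟨⟨t, ht, hm⟩, h⟩⟩
  have clause : ∀ (t : (typeModel.{u} L n S t₀ h₀).W), ∀ m < n + 1, Clause L n S t.down m :=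
    fun t => hS _ t.down.2.1 t.down.2.2
  induction φ with
  | var p =>
    intro t
    simp only [Formula.toNat] at hφ
    simp only [Model.Pos, Model.Neg, typeModel, Formula.toNat, hφ, true_and]
  | neg φ ih =>
    intro t
    have c := (clause t _ hφ).neg
    simp only [Formula.toNat] at hφ c ⊢
    rw [show (7 * φ.toNat + 1) / 7 = φ.toNat by omega] at c
    simp only [Model.Pos, Model.Neg]
    have i := ih (by omega) t
    have c := c (by omega)
    exact ⟨i.2.trans c.1.symm, i.1.trans c.2.symm⟩
  | and φ χ ih₁ ih₂ =>
    intro t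
    have c := (clause t _ hφ).and
    simp only [Formula.toNat] at hφ c ⊢
    have hl := Nat.left_le_pair φ.toNat χ.toNat
    have hr := Nat.right_le_pair φ.toNat χ.toNat
    rw [show (7 * Nat.pair φ.toNat χ.toNat + 2) / 7 = Nat.pair φ.toNat χ.toNat by omega,
      Nat.unpair_pair] at c
    have c := c (by omega)
    have i₁ := ih₁ (by omega) t
    have i₂ := ih₂ (by omega) t
    simp only [Model.Pos, Model.Neg, c, i₁, i₂, and_self]
  | or φ χ ih₁ ih₂ =>
    intro t
    have c := (clause t _ hφ).or
    simp only [Formula.toNat] at hφ c ⊢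
    have hl := Nat.left_le_pair φ.toNat χ.toNat
    have hr := Nat.right_le_pair φ.toNat χ.toNat
    rw [show (7 * Nat.pair φ.toNat χ.toNat + 3) / 7 = Nat.pair φ.toNat χ.toNat by omega,
      Nat.unpair_pair] at c
    have c := c (by omega)
    have i₁ := ih₁ (by omega) t
    have i₂ := ih₂ (by omega) t
    simp only [Model.Pos, Model.Neg, c, i₁, i₂, and_self]
  | imp φ χ ih₁ ih₂ =>
    intro t
    have c := (clause t _ hφ).imp
    simp only [Formula.toNat] at hφ c ⊢
    have hl := Nat.left_le_pair φ.toNat χ.toNat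
    have hr := Nat.right_le_pair φ.toNat χ.toNat
    rw [show (7 * Nat.pair φ.toNat χ.toNat + 4) / 7 = Nat.pair φ.toNat χ.toNat by omega,
      Nat.unpair_pair] at c
    have c := c (by omega)
    have i₁ := ih₁ (by omega)
    have i₂ := ih₂ (by omega)
    simp only [Model.Pos, Model.Neg, c, i₁, i₂, and_true]
    exact worlds_forall fun t' => Below n t.down t' →
      Has t' .pos φ.toNat → Has t' .pos χ.toNat
  | box φ ih =>
    intro t
    have m := (clause t _ hφ).modal
    have c := fun t => (clause t _ hφ).box
    simp only [Formula.toNat] at hφ m c ⊢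
    rw [show (7 * φ.toNat + 5) / 7 = φ.toNat by omega] at c
    have m := m (by omega)
    have c := fun t => c t (by omega)
    have i := ih (by omega)
    have hp : ∀ t, _ ↔ _ := fun t => (worlds_forall fun t' => Acc L n .boxPos t.down t' →
      Has t' .pos φ.toNat).trans (c t).1.symm
    have hn : ∀ t, _ ↔ _ := fun t => (worlds_exists fun t' => Acc L n .boxNeg t.down t' ∧
      Has t' .neg φ.toNat).trans (c t).2.symm
    simp only [Model.Pos, Model.Neg, i, m]
    simp only [typeModel] at hp hn worlds_forall ⊢
    simp only [hp, hn]
    exact ⟨worlds_forall fun t' => Below n t.down t' → Has t' .posLocal _,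
      worlds_forall fun t' => Below n t.down t' → Has t' .negLocal _⟩
  | dia φ ih =>
    intro t
    have m := (clause t _ hφ).modal
    have c := fun t => (clause t _ hφ).dia
    simp only [Formula.toNat] at hφ m c ⊢
    rw [show (7 * φ.toNat + 6) / 7 = φ.toNat by omega] at c
    have m := m (by omega)
    have c := fun t => c t (by omega)
    have i := ih (by omega)
    have hp : ∀ t, _ ↔ _ := fun t => (worlds_exists fun t' => Acc L n .diaPos t.down t' ∧
      Has t' .pos φ.toNat).trans (c t).1.symm
    have hn : ∀ t, _ ↔ _ := fun t => (worlds_forall fun t' => Acc L n .diaNeg t.down t' →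
      Has t' .neg φ.toNat).trans (c t).2.symm
    simp only [Model.Pos, Model.Neg, i, m]
    simp only [typeModel] at hp hn worlds_forall ⊢
    simp only [hp, hn]
    exact ⟨worlds_forall fun t' => Below n t.down t' → Has t' .posLocal _,
      worlds_forall fun t' => Below n t.down t' → Has t' .negLocal _⟩

/-! ### From models to coherent sets -/

/-- A mark on a formula is correct at a world. Local marks are never correct on formulas that are
not modal. -/
def Model.Sem (M : Model.{u}) : Mark → Formula → M.W → Prop
  | .pos, φ, w => M.Pos φ w
  | .neg, φ, w => M.Neg φ w
  | .posLocal, .box φ, w => ∀ w', M.boxPos w w' → M.Pos φ w'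
  | .posLocal, .dia φ, w => ∃ w', M.diaPos w w' ∧ M.Pos φ w'
  | .posLocal, _, _ => False
  | .negLocal, .box φ, w => ∃ w', M.boxNeg w w' ∧ M.Neg φ w'
  | .negLocal, .dia φ, w => ∀ w', M.diaNeg w w' → M.Neg φ w'
  | .negLocal, _, _ => False

theorem exists_testBit_iff (K : ℕ) (p : ℕ → Prop) :
    ∃ s < 2 ^ K, ∀ i < K, s.testBit i = true ↔ p i := by
  classical
  refine ⟨Nat.ofBits fun i : Fin K => decide (p i), Nat.ofBits_lt_two_pow _, fun i hi => ?_⟩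
  rw [Nat.testBit_ofBits_lt _ _ hi]
  simp

theorem Model.exists_type (M : Model.{u}) (n : ℕ) (w : M.W) :
    ∃ t < typeBound n, ∀ k φ, φ.toNat < n + 1 → (Has t k φ.toNat ↔ M.Sem k φ w) := by
  obtain ⟨t, ht, h⟩ := exists_testBit_iff (4 * (n + 1))
    fun i => ∃ k φ, i = 4 * φ.toNat + Mark.index k ∧ M.Sem k φ w
  refine ⟨t, ht, fun k φ hφ => ?_⟩
  have hk : k.index < 4 := by cases k <;> decide
  rw [Has, h _ (by omega)]
  constructor
  · rintro ⟨k', φ', e, hs⟩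
    have hk' : k'.index < 4 := by cases k' <;> decide
    obtain rfl : φ = φ' := Formula.toNat_injective (by omega)
    obtain rfl : k = k' := by
      have : k.index = k'.index := by omega
      cases k <;> cases k' <;> simp_all [Mark.index]
    exact hs
  · exact fun hs => ⟨k, φ, rfl, hs⟩

/-- Types of related worlds are related, by every relation that `L` identifies with the given
one. -/
theorem Model.acc_of_rel {M : Model.{u}} {L : Logic} (hM : L.IsFrame M.toFrame) {n t t' : ℕ}
    {w w' : M.W} (ht : ∀ k φ, φ.toNat < n + 1 → (Has t k φ.toNat ↔ M.Sem k φ w))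
    (ht' : ∀ k φ, φ.toNat < n + 1 → (Has t' k φ.toNat ↔ M.Sem k φ w')) (r : Rel)
    (h : M.rel r w w') : Acc L n r t t' := by
  intro r' hr m hm
  rw [(L.isFrame_iff M.toFrame).1 hM r r' hr] at h
  obtain ⟨φ, rfl⟩ := Formula.toNat_surjective m
  cases φ with
  | box φ =>
    have e : φ.box.toNat / 7 = φ.toNat := by simp only [Formula.toNat]; omega
    have e' : φ.box.toNat % 7 = 5 := by simp only [Formula.toNat]; omega
    have hφ : φ.toNat < n + 1 := by omega
    cases r' <;> simp only [Respects, e, e', ht _ _ hm, ht' _ _ hφ, Model.Sem]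
    · exact fun _ hs => hs _ h
    · exact fun _ hs => ⟨_, h, hs⟩
    · omega
    · omega
  | dia φ =>
    have e : φ.dia.toNat / 7 = φ.toNat := by simp only [Formula.toNat]; omega
    have e' : φ.dia.toNat % 7 = 6 := by simp only [Formula.toNat]; omega
    have hφ : φ.toNat < n + 1 := by omega
    cases r' <;> simp only [Respects, e, e', ht _ _ hm, ht' _ _ hφ, Model.Sem]
    · omega
    · omega
    · exact fun _ hs => ⟨_, h, hs⟩
    · exact fun _ hs => hs _ h
  | _ => cases r' <;> simp only [Respects, Formula.toNat] <;> omega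

/-- A set consisting of the types of all worlds of a model is coherent. -/
theorem coherent_realized {M : Model.{u}} {L : Logic} (hM : L.IsFrame M.toFrame) {n S : ℕ}
    {τ : M.W → ℕ} (hτ : ∀ w, τ w < typeBound n)
    (hsem : ∀ w k φ, φ.toNat < n + 1 → (Has (τ w) k φ.toNat ↔ M.Sem k φ w))
    (hS : ∀ t < typeBound n, Mem S t ↔ ∃ w, τ w = t) : Coherent L n S := by
  have types_forall : ∀ p : ℕ → Prop,
      (∀ t < typeBound n, Mem S t → p t) ↔ ∀ w, p (τ w) := by
    intro p
    constructor
    · exact fun h w => h _ (hτ w) ((hS _ (hτ w)).2 ⟨w, rfl⟩)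
    · intro h t ht hm
      obtain ⟨w, rfl⟩ := (hS t ht).1 hm
      exact h w
  have types_exists : ∀ p : ℕ → Prop,
      (∃ t < typeBound n, Mem S t ∧ p t) ↔ ∃ w, p (τ w) := by
    intro p
    constructor
    · rintro ⟨t, ht, hm, h⟩
      obtain ⟨w, rfl⟩ := (hS t ht).1 hm
      exact ⟨w, h⟩
    · exact fun ⟨w, h⟩ => ⟨_, hτ w, (hS _ (hτ w)).2 ⟨w, rfl⟩, h⟩
  have below : ∀ w w', M.le w w' → Below n (τ w) (τ w') := by
    intro w w' h m hm
    obtain ⟨φ, rfl⟩ := Formula.toNat_surjective m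
    simp only [hsem _ _ _ hm, Model.Sem]
    exact M.persistent φ w w' h
  have acc : ∀ r w w', M.rel r w w' → Acc L n r (τ w) (τ w') :=
    fun r w w' h => Model.acc_of_rel hM (hsem w) (hsem w') r h
  -- A modal formula is supported at `w` exactly when its local condition holds at every world whose
  -- type lies above that of `w`: support is a mark, so it passes to those worlds.
  have modal : ∀ (φ : Formula) (k l : Mark), φ.toNat < n + 1 →
      (∀ w w', Below n (τ w) (τ w') → M.Sem k φ w → M.Sem k φ w') →
      (∀ w, M.Sem k φ w ↔ ∀ w', M.le w w' → M.Sem l φ w') → ∀ w,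
      (Has (τ w) k φ.toNat ↔ ∀ t < typeBound n, Mem S t → Below n (τ w) t → Has t l φ.toNat) := by
    intro φ k l hφ hmono hk w
    rw [types_forall fun t => Below n (τ w) t → Has t l φ.toNat]
    simp only [hsem _ _ _ hφ]
    exact ⟨fun h w' hb => (hk w').1 (hmono w w' hb h) w' (M.le_refl w'),
      fun h => (hk w).2 fun w' hle => h w' (below w w' hle)⟩
  have hpos : ∀ φ : Formula, φ.toNat < n + 1 →
      ∀ w w', Below n (τ w) (τ w') → M.Sem .pos φ w → M.Sem .pos φ w' := by
    intro φ hφ w w' hb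
    rw [← hsem w _ _ hφ, ← hsem w' _ _ hφ]
    exact (hb _ hφ).1
  have hneg : ∀ φ : Formula, φ.toNat < n + 1 →
      ∀ w w', Below n (τ w) (τ w') → M.Sem .neg φ w → M.Sem .neg φ w' := by
    intro φ hφ w w' hb
    rw [← hsem w _ _ hφ, ← hsem w' _ _ hφ]
    exact (hb _ hφ).2
  intro t ht hm m hmn
  obtain ⟨w, rfl⟩ := (hS t ht).1 hm
  obtain ⟨φ, rfl⟩ := Formula.toNat_surjective m
  cases φ with
  | var p => constructor <;> simp only [Formula.toNat] <;> omega
  | neg φ =>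
    have e : φ.neg.toNat / 7 = φ.toNat := by simp only [Formula.toNat]; omega
    have e' : φ.neg.toNat % 7 = 1 := by simp only [Formula.toNat]; omega
    have hφ : φ.toNat < n + 1 := by omega
    constructor <;> rw [e'] <;> try omega
    intro _
    simp only [e, hsem _ _ _ hmn, hsem _ _ _ hφ, Model.Sem, Model.Pos, Model.Neg, and_self]
  | and φ χ =>
    have e : (φ.and χ).toNat / 7 = Nat.pair φ.toNat χ.toNat := by
      simp only [Formula.toNat]; omega
    have e' : (φ.and χ).toNat % 7 = 2 := by simp only [Formula.toNat]; omega
    have hφ : φ.toNat < n + 1 := by have := Nat.left_le_pair φ.toNat χ.toNat; omega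
    have hχ : χ.toNat < n + 1 := by have := Nat.right_le_pair φ.toNat χ.toNat; omega
    constructor <;> rw [e'] <;> try omega
    intro _
    simp only [e, Nat.unpair_pair, hsem _ _ _ hmn, hsem _ _ _ hφ, hsem _ _ _ hχ, Model.Sem,
      Model.Pos, Model.Neg, and_self]
  | or φ χ =>
    have e : (φ.or χ).toNat / 7 = Nat.pair φ.toNat χ.toNat := by
      simp only [Formula.toNat]; omega
    have e' : (φ.or χ).toNat % 7 = 3 := by simp only [Formula.toNat]; omega
    have hφ : φ.toNat < n + 1 := by have := Nat.left_le_pair φ.toNat χ.toNat; omega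
    have hχ : χ.toNat < n + 1 := by have := Nat.right_le_pair φ.toNat χ.toNat; omega
    constructor <;> rw [e'] <;> try omega
    intro _
    simp only [e, Nat.unpair_pair, hsem _ _ _ hmn, hsem _ _ _ hφ, hsem _ _ _ hχ, Model.Sem,
      Model.Pos, Model.Neg, and_self]
  | imp φ χ =>
    have e : (φ.imp χ).toNat / 7 = Nat.pair φ.toNat χ.toNat := by
      simp only [Formula.toNat]; omega
    have e' : (φ.imp χ).toNat % 7 = 4 := by simp only [Formula.toNat]; omega
    have hφ : φ.toNat < n + 1 := by have := Nat.left_le_pair φ.toNat χ.toNat; omega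
    have hχ : χ.toNat < n + 1 := by have := Nat.right_le_pair φ.toNat χ.toNat; omega
    constructor <;> rw [e'] <;> try omega
    intro _
    rw [e, Nat.unpair_pair, types_forall fun t => Below n (τ w) t →
      Has t .pos φ.toNat → Has t .pos χ.toNat]
    have up := hpos _ hmn w
    simp only [hsem _ _ _ hmn, hsem _ _ _ hφ, hsem _ _ _ hχ, Model.Sem, Model.Pos, Model.Neg,
      and_true] at up ⊢
    exact ⟨fun h w' hb => up w' hb h w' (M.le_refl w'), fun h w' hle => h w' (below w w' hle)⟩
  | box φ =>
    have e : φ.box.toNat / 7 = φ.toNat := by simp only [Formula.toNat]; omega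
    have e' : φ.box.toNat % 7 = 5 := by simp only [Formula.toNat]; omega
    have hφ : φ.toNat < n + 1 := by omega
    constructor <;> (try (rw [e']; omega)) <;> intro _
    · rw [e, types_forall fun t => Acc L n .boxPos (τ w) t → Has t .pos φ.toNat,
        types_exists fun t => Acc L n .boxNeg (τ w) t ∧ Has t .neg φ.toNat]
      constructor
      · constructor
        · intro h w' ha
          have := ha .boxPos rfl _ hmn e' h
          rwa [e] at this
        · intro h
          rw [hsem _ _ _ hmn]
          exact fun w' hr => (hsem w' .pos φ hφ).1 (h w' (acc .boxPos _ _ hr))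
      · constructor
        · intro h
          obtain ⟨w', hr, hs⟩ := (hsem w .negLocal _ hmn).1 h
          exact ⟨w', acc .boxNeg _ _ hr, (hsem w' .neg φ hφ).2 hs⟩
        · rintro ⟨w', ha, hs⟩
          exact ha .boxNeg rfl _ hmn e' (by rwa [e])
    · refine ⟨modal _ _ _ hmn (hpos _ hmn) ?_ w, modal _ _ _ hmn (hneg _ hmn) ?_ w⟩ <;>
        simp only [Model.Sem, Model.Pos, Model.Neg, implies_true]
  | dia φ =>
    have e : φ.dia.toNat / 7 = φ.toNat := by simp only [Formula.toNat]; omega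
    have e' : φ.dia.toNat % 7 = 6 := by simp only [Formula.toNat]; omega
    have hφ : φ.toNat < n + 1 := by omega
    constructor <;> (try (rw [e']; omega)) <;> intro _
    · rw [e, types_exists fun t => Acc L n .diaPos (τ w) t ∧ Has t .pos φ.toNat,
        types_forall fun t => Acc L n .diaNeg (τ w) t → Has t .neg φ.toNat]
      constructor
      · constructor
        · intro h
          obtain ⟨w', hr, hs⟩ := (hsem w .posLocal _ hmn).1 h
          exact ⟨w', acc .diaPos _ _ hr, (hsem w' .pos φ hφ).2 hs⟩
        · rintro ⟨w', ha, hs⟩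
          exact ha .diaPos rfl _ hmn e' (by rwa [e])
      · constructor
        · intro h w' ha
          have := ha .diaNeg rfl _ hmn e' h
          rwa [e] at this
        · intro h
          rw [hsem _ _ _ hmn]
          exact fun w' hr => (hsem w' .neg φ hφ).1 (h w' (acc .diaNeg _ _ hr))
    · refine ⟨modal _ _ _ hmn (hpos _ hmn) ?_ w, modal _ _ _ hmn (hneg _ hmn) ?_ w⟩ <;>
        simp only [Model.Sem, Model.Pos, Model.Neg, implies_true]

theorem not_valid_iff_refutable (L : Logic) (φ : Formula) :
    ¬ L.Valid.{u} φ ↔ Refutable L φ.toNat := by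
  constructor
  · intro h
    simp only [Logic.Valid, not_forall] at h
    obtain ⟨M, hM, w, hw⟩ := h
    choose τ hτ hsem using M.exists_type φ.toNat
    obtain ⟨S, hlt, hS⟩ := exists_testBit_iff (typeBound φ.toNat) fun t => ∃ w, τ w = t
    refine ⟨S, hlt, coherent_realized hM hτ hsem hS, τ w, hτ w, (hS _ (hτ w)).2 ⟨w, rfl⟩, ?_⟩
    rwa [hsem _ _ _ (Nat.lt_succ_self _)]
  · rintro ⟨S, -, hS, t, ht, hm, hn⟩ hv
    exact hn ((hS.support_iff ⟨ht, hm⟩ φ (Nat.lt_succ_self _) ⟨t, ht, hm⟩).1.1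
      (hv _ (typeModel_isFrame L _ S t ⟨ht, hm⟩) _))

/-! ### Primitive recursiveness of refutability -/

section Computability

variable {α : Type*} [Primcodable α]

theorem primrecPred_imp {p q : α → Prop} (hp : PrimrecPred p) (hq : PrimrecPred q) :
    PrimrecPred fun a => p a → q a :=
  (hp.not.or hq).of_eq fun _ => imp_iff_not_or.symm

theorem primrecPred_iff {p q : α → Prop} (hp : PrimrecPred p) (hq : PrimrecPred q) :
    PrimrecPred fun a => p a ↔ q a :=
  ((primrecPred_imp hp hq).and (primrecPred_imp hq hp)).of_eq fun _ =>
    iff_iff_implies_and_implies.symm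

theorem primrecPred_exists_lt {p : α × ℕ → Prop} {f : α → ℕ} (hf : Primrec f)
    (hp : PrimrecPred p) : PrimrecPred fun a => ∃ x < f a, p (a, x) :=
  ((PrimrecRel.exists_mem_list (R := fun x a => p (a, x))
    (hp.comp (Primrec.snd.pair Primrec.fst))).comp (Primrec.list_range.comp hf) Primrec.id).of_eq
    fun _ => by simp

theorem primrecPred_forall_lt {p : α × ℕ → Prop} {f : α → ℕ} (hf : Primrec f)
    (hp : PrimrecPred p) : PrimrecPred fun a => ∀ x < f a, p (a, x) :=
  (primrecPred_exists_lt hf hp.not).not.of_eq fun _ => by simp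

theorem primrecPred_const (c : Prop) : PrimrecPred fun _ : α => c := by
  by_cases h : c
  · exact ((Primrec.eq (α := ℕ)).comp (.const 0) (.const 0)).of_eq fun _ => by simp [h]
  · exact ((Primrec.eq (α := ℕ)).comp (.const 0) (.const 1)).of_eq fun _ => by simp [h]

theorem primrec_two_pow {f : α → ℕ} (hf : Primrec f) : Primrec fun a => 2 ^ f a :=
  (Primrec₂.unpaired'.1 Nat.Primrec.pow).comp (.const 2) hf

theorem primrecPred_testBit {s i : α → ℕ} (hs : Primrec s) (hi : Primrec i) :
    PrimrecPred fun a => (s a).testBit (i a) = true :=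
  (Primrec.eq.comp (Primrec.nat_mod.comp (Primrec.nat_div.comp hs (primrec_two_pow hi)) (.const 2))
    (.const 1)).of_eq fun _ => by simp [Nat.testBit_eq_decide_div_mod_eq]

theorem primrec_typeBound {n : α → ℕ} (hn : Primrec n) : Primrec fun a => typeBound (n a) :=
  primrec_two_pow (Primrec.nat_mul.comp (.const 4) (Primrec.succ.comp hn))

theorem primrecPred_mem {s t : α → ℕ} (hs : Primrec s) (ht : Primrec t) :
    PrimrecPred fun a => Mem (s a) (t a) :=
  primrecPred_testBit hs ht

theorem primrecPred_has {t m : α → ℕ} (k : Mark) (ht : Primrec t) (hm : Primrec m) :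
    PrimrecPred fun a => Has (t a) k (m a) :=
  primrecPred_testBit ht
    (Primrec.nat_add.comp (Primrec.nat_mul.comp (.const 4) hm) (.const k.index))

theorem primrecPred_below {n t t' : α → ℕ} (hn : Primrec n) (ht : Primrec t) (ht' : Primrec t') :
    PrimrecPred fun a => Below (n a) (t a) (t' a) := by
  have ht := ht.comp (Primrec.fst (β := ℕ))
  have ht' := ht'.comp (Primrec.fst (β := ℕ))
  exact primrecPred_forall_lt (Primrec.succ.comp hn)
    ((primrecPred_imp (primrecPred_has _ ht .snd) (primrecPred_has _ ht' .snd)).and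
      (primrecPred_imp (primrecPred_has _ ht .snd) (primrecPred_has _ ht' .snd)))

theorem primrecPred_mod_seven {m : α → ℕ} (hm : Primrec m) (c : ℕ) :
    PrimrecPred fun a => m a % 7 = c :=
  Primrec.eq.comp (Primrec.nat_mod.comp hm (.const 7)) (.const c)

theorem primrecPred_respects {m t t' : α → ℕ} (hm : Primrec m) (ht : Primrec t)
    (ht' : Primrec t') (r : Rel) : PrimrecPred fun a => Respects (m a) (t a) (t' a) r := by
  have hd := Primrec.nat_div.comp hm (.const 7)
  cases r
  · exact primrecPred_imp (primrecPred_mod_seven hm 5)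
      (primrecPred_imp (primrecPred_has _ ht hm) (primrecPred_has _ ht' hd))
  · exact primrecPred_imp (primrecPred_mod_seven hm 5)
      (primrecPred_imp (primrecPred_has _ ht' hd) (primrecPred_has _ ht hm))
  · exact primrecPred_imp (primrecPred_mod_seven hm 6)
      (primrecPred_imp (primrecPred_has _ ht' hd) (primrecPred_has _ ht hm))
  · exact primrecPred_imp (primrecPred_mod_seven hm 6)
      (primrecPred_imp (primrecPred_has _ ht hm) (primrecPred_has _ ht' hd))

theorem primrecPred_acc (L : Logic) (r : Rel) {n t t' : α → ℕ} (hn : Primrec n) (ht : Primrec t)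
    (ht' : Primrec t') : PrimrecPred fun a => Acc L (n a) r (t a) (t' a) := by
  have h : ∀ r', PrimrecPred fun a =>
      L.rep r = L.rep r' → ∀ m < n a + 1, Respects m (t a) (t' a) r' := fun r' =>
    primrecPred_imp (primrecPred_const _) (primrecPred_forall_lt (Primrec.succ.comp hn)
      (primrecPred_respects .snd (ht.comp .fst) (ht'.comp .fst) r'))
  refine ((h .boxPos).and ((h .boxNeg).and ((h .diaPos).and (h .diaNeg)))).of_eq fun a => ?_
  exact ⟨fun ⟨h₁, h₂, h₃, h₄⟩ r' => by cases r' <;> assumption,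
    fun h => ⟨h .boxPos, h .boxNeg, h .diaPos, h .diaNeg⟩⟩

theorem primrecPred_forall_type {n S : α → ℕ} {p : α × ℕ → Prop} (hn : Primrec n)
    (hS : Primrec S) (hp : PrimrecPred p) :
    PrimrecPred fun a => ∀ t < typeBound (n a), Mem (S a) t → p (a, t) :=
  primrecPred_forall_lt (primrec_typeBound hn)
    (primrecPred_imp (primrecPred_mem (hS.comp .fst) .snd) hp)

theorem primrecPred_exists_type {n S : α → ℕ} {p : α × ℕ → Prop} (hn : Primrec n)
    (hS : Primrec S) (hp : PrimrecPred p) :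
    PrimrecPred fun a => ∃ t < typeBound (n a), Mem (S a) t ∧ p (a, t) :=
  primrecPred_exists_lt (primrec_typeBound hn)
    ((primrecPred_mem (hS.comp .fst) .snd).and hp)

theorem primrecPred_clause (L : Logic) {n S t m : α → ℕ} (hn : Primrec n) (hS : Primrec S)
    (ht : Primrec t) (hm : Primrec m) :
    PrimrecPred fun a => Clause L (n a) (S a) (t a) (m a) := by
  have hd := Primrec.nat_div.comp hm (.const 7)
  have hl := Primrec.fst.comp (Primrec.unpair.comp hd)
  have hr := Primrec.snd.comp (Primrec.unpair.comp hd)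
  have has := fun k => primrecPred_has k ht hm
  have hasd := fun k => primrecPred_has k ht hd
  have hasl := fun k => primrecPred_has k ht hl
  have hasr := fun k => primrecPred_has k ht hr
  have hn' := hn.comp (Primrec.fst (β := ℕ))
  have ht' := ht.comp (Primrec.fst (β := ℕ))
  have has' := fun k => primrecPred_has k Primrec.snd (hm.comp (Primrec.fst (β := ℕ)))
  have hasd' := fun k => primrecPred_has k Primrec.snd (hd.comp (Primrec.fst (β := ℕ)))
  have hasl' := fun k => primrecPred_has k Primrec.snd (hl.comp (Primrec.fst (β := ℕ)))
  have hasr' := fun k => primrecPred_has k Primrec.snd (hr.comp (Primrec.fst (β := ℕ)))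
  have below := primrecPred_below hn' ht' Primrec.snd
  have acc := fun r => primrecPred_acc L r hn' ht' Primrec.snd
  have c₁ := primrecPred_imp (primrecPred_mod_seven hm 1)
    ((primrecPred_iff (has .pos) (hasd .neg)).and (primrecPred_iff (has .neg) (hasd .pos)))
  have c₂ := primrecPred_imp (primrecPred_mod_seven hm 2)
    ((primrecPred_iff (has .pos) ((hasl .pos).and (hasr .pos))).and
      (primrecPred_iff (has .neg) ((hasl .neg).or (hasr .neg))))
  have c₃ := primrecPred_imp (primrecPred_mod_seven hm 3)
    ((primrecPred_iff (has .pos) ((hasl .pos).or (hasr .pos))).and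
      (primrecPred_iff (has .neg) ((hasl .neg).and (hasr .neg))))
  have c₄ := primrecPred_imp (primrecPred_mod_seven hm 4)
    ((primrecPred_iff (has .pos) (primrecPred_forall_type hn hS
        (primrecPred_imp below (primrecPred_imp (hasl' .pos) (hasr' .pos))))).and
      (primrecPred_iff (has .neg) ((hasl .pos).and (hasr .neg))))
  have c₅ := primrecPred_imp (primrecPred_mod_seven hm 5)
    ((primrecPred_iff (has .posLocal) (primrecPred_forall_type hn hS
        (primrecPred_imp (acc .boxPos) (hasd' .pos)))).and
      (primrecPred_iff (has .negLocal) (primrecPred_exists_type hn hS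
        ((acc .boxNeg).and (hasd' .neg)))))
  have c₆ := primrecPred_imp (primrecPred_mod_seven hm 6)
    ((primrecPred_iff (has .posLocal) (primrecPred_exists_type hn hS
        ((acc .diaPos).and (hasd' .pos)))).and
      (primrecPred_iff (has .negLocal) (primrecPred_forall_type hn hS
        (primrecPred_imp (acc .diaNeg) (hasd' .neg)))))
  have c₇ := primrecPred_imp ((primrecPred_mod_seven hm 5).or (primrecPred_mod_seven hm 6))
    ((primrecPred_iff (has .pos) (primrecPred_forall_type hn hS
        (primrecPred_imp below (has' .posLocal)))).and
      (primrecPred_iff (has .neg) (primrecPred_forall_type hn hS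
        (primrecPred_imp below (has' .negLocal)))))
  exact (c₁.and (c₂.and (c₃.and (c₄.and (c₅.and (c₆.and c₇)))))).of_eq fun a =>
    ⟨fun ⟨h₁, h₂, h₃, h₄, h₅, h₆, h₇⟩ => ⟨h₁, h₂, h₃, h₄, h₅, h₆, h₇⟩,
      fun h => ⟨h.neg, h.and, h.or, h.imp, h.box, h.dia, h.modal⟩⟩

theorem primrecPred_coherent (L : Logic) {n S : α → ℕ} (hn : Primrec n) (hS : Primrec S) :
    PrimrecPred fun a => Coherent L (n a) (S a) :=
  primrecPred_forall_type hn hS (primrecPred_forall_lt (Primrec.succ.comp (hn.comp .fst))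
    (primrecPred_clause L (hn.comp (Primrec.fst.comp .fst)) (hS.comp (Primrec.fst.comp .fst))
      (Primrec.snd.comp .fst) .snd))

theorem primrecPred_refutable (L : Logic) : PrimrecPred (Refutable L) :=
  primrecPred_exists_lt (primrec_two_pow (primrec_typeBound .id))
    ((primrecPred_coherent L .fst .snd).and
      (primrecPred_exists_type .fst .snd
        (primrecPred_has .pos .snd (Primrec.fst.comp .fst)).not))

end Computability

theorem Formula.primrec_toNat : Primrec Formula.toNat :=
  (Primrec.of_equiv (e := Formula.equivNat))

end CN4K

theorem mainTheorem3 (L : CN4K.Logic) :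
    ComputablePred (fun φ : CN4K.Formula => CN4K.Logic.Valid.{u} L φ) := by
  refine PrimrecPred.computablePred ?_
  exact ((CN4K.primrecPred_refutable L).comp CN4K.Formula.primrec_toNat).not.of_eq fun φ => by
    rw [← CN4K.not_valid_iff_refutable.{u}, not_not]
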